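/- Let $(\mathcal U,\delta)$ be an uncountable saturated differentially closed field of characteristic zero with one derivation, and let $C$ be its field of constants (for example $C=\mathbb C$). Differential fields $K,F,\dots$ below are differential subfields of $\mathcal U$ of cardinality less than $|\mathcal U|$; $K\langle y\rangle$ is the differential field generated over $K$ by a finite tuple $y$ from $\mathcal U$, and $K^{alg}$ is the algebraic closure of $K$ in $\mathcal U$. A definable set over $K$ is a finite Boolean combination of zero sets in $\mathcal U^m$ of finite systems of differential polynomials over $K$; $\mathrm{ord}(X)=\sup\{\mathrm{tr.deg}_K K\langle y\rangle : y\in X\}$, and $y\in X$ is generic over $K$ if $\mathrm{tr.deg}_K K\langle y\rangle=\mathrm{ord}(X)$. Write $\mathrm{tp}(y/K)$ for the complete type of $y$ over $K$; it is determined by the set of differential polynomials over $K$ that vanish at $y$. - $\mathrm{tp}(y/K)$ is stationary if every realisation of $\mathrm{tp}(y/K)$ realises $\mathrm{tp}(y/K^{alg})$. It is internal to the constants if there is $F\supseteq K$ such that every realisation $z$ of $\mathrm{tp}(y/K)$ lies in $F(c_1,\dots,c_k)$ for some $c_1,\dots,c_k\in C$. - $\mathrm{tp}(y/K)$ is analyzable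 in the constants if there are finite tuples $y_0,\dots,y_N$ from $\mathcal U$ with $y\in K\langle y_0,\dots,y_N\rangle^{alg}$ such that for each $i\le N$ either $y_i\in K\langle y_0,\dots,y_{i-1}\rangle^{alg}$ or $\mathrm{tp}(y_i/K\langle y_0,\dots,y_{i-1}\rangle)$ is stationary and internal to the constants. - A set $X$ definable over $K$ is orthogonal to the constants if there are no $F\supseteq K$ and $a\in X$ such that $F\langle a\rangle$ contains a constant that is not in $F^{alg}$. - $y$ is Liouvillian over $K$ if its coordinates lie in some $F_r$, where $K=F_0\subseteq F_1\subseteq\dots\subseteq F_r$ are differential fields and for each $1\le i\le r$ one has $F_i=F_{i-1}(\alpha)$ with $\delta\alpha\in F_{i-1}$, or $\alpha\neq0$ and $\delta\alpha/\alpha\in F_{i-1}$, or $\alpha\in F_{i-1}^{alg}$. **Theorem.** Let $K$ be a finitely generated differential field and let $X\subseteq\mathcal U^m$ be (the solution set of) a differential equation or system of finite order $n$ over $K$, that is, a set definable over $K$ with $\mathrm{ord}(X)=n$. 1. If $y\in X$ is generic over $K$ and $\mathrm{tp}(y/K)$ is not analyzable in the constants, then $y$ is not Liouvillian over $K$. 2.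 If $X$ is orthogonal to the constants, then no solution $f\in X$ with $f\notin K^{alg}$ is Liouvillian over $K$. -/

import Mathlib

namespace DiffAlg

open Cardinal

variable {U : Type*} [Field U] [CharZero U] [Differential U]

/-- The `j`-th derivative of an element of `U`. -/
def iterDeriv (j : ℕ) (x : U) : U := (fun z : U => Differential.deriv z)^[j] x

/-- `K` is a differential subfield of `U`. -/
def IsDiffSubfield (K : Subfield U) : Prop := ∀ x ∈ K, Differential.deriv x ∈ K

/-- `K⟨S⟩`: the field generated over `K` by the elements of `S` and all their derivatives. -/
def diffAdjoin (K : Subfield U) (S : Set U) : IntermediateField K U :=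
  IntermediateField.adjoin K {x | ∃ s ∈ S, ∃ j : ℕ, x = iterDeriv j s}

/-- The differential subfield of `U` generated (over the prime field) by `A`. -/
def diffClosure (A : Set U) : Subfield U := (diffAdjoin (⊥ : Subfield U) A).toSubfield

/-- `K` is a finitely generated differential field. -/
def IsFinGenDiffField (K : Subfield U) : Prop := ∃ s : Finset U, K = diffClosure (s : Set U)

/-- The algebraic closure of `K` in `U`. -/
def algClosure (K : Subfield U) : Subfield U := (algebraicClosure K U).toSubfield

/-- The value at the tuple `y` of a differential polynomial over `K` in `m` variables; the
variable `(i, j)` stands for the `j`-th derivative of the `i`-th variable. -/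
noncomputable def diffEval (K : Subfield U) {m : ℕ} (y : Fin m → U)
    (p : MvPolynomial (Fin m × ℕ) K) : U :=
  MvPolynomial.aeval (fun v : Fin m × ℕ => iterDeriv v.2 (y v.1)) p

/-- Sets definable over `K`: the finite Boolean combinations of Kolchin closed sets over `K`. -/
inductive IsDefinableOver (K : Subfield U) {m : ℕ} : Set (Fin m → U) → Prop
  | kolchinClosed (s : Finset (MvPolynomial (Fin m × ℕ) K)) :
      IsDefinableOver K {y | ∀ p ∈ s, diffEval K y p = 0}
  | compl {X : Set (Fin m → U)} : IsDefinableOver K X → IsDefinableOver K Xᶜ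
  | inter {X Y : Set (Fin m → U)} :
      IsDefinableOver K X → IsDefinableOver K Y → IsDefinableOver K (X ∩ Y)

variable (U) in
/-- Differentially closed (Blum): if `f` has order `n`, and `g ≠ 0` has order less than `n`
(nonzero constants have order less than `0`), then some `a` has `f(a) = 0` and `g(a) ≠ 0`. -/
def IsDifferentiallyClosed : Prop :=
  ∀ (n : ℕ) (f g : MvPolynomial ℕ U),
    n ∈ f.vars → (∀ j ∈ f.vars, j ≤ n) → g ≠ 0 → (∀ j ∈ g.vars, j < n) →
    ∃ a : U, MvPolynomial.aeval (fun j : ℕ => iterDeriv j a) f = 0 ∧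
      MvPolynomial.aeval (fun j : ℕ => iterDeriv j a) g ≠ 0

variable (U) in
/-- Saturation: every finitely satisfiable family of sets that are definable over a set of fewer
than `#U` parameters has a common point. -/
def IsSaturated : Prop :=
  ∀ A : Set U, #A < #U → ∀ (m : ℕ) (S : Set (Set (Fin m → U))),
    (∀ X ∈ S, IsDefinableOver (diffClosure A) X) →
    (∀ T : Finset (Set (Fin m → U)), (T : Set (Set (Fin m → U))) ⊆ S →
      (⋂₀ (T : Set (Set (Fin m → U)))).Nonempty) →
    (⋂₀ S).Nonempty

variable (U) in
/-- `U` is an uncountable saturated differentially closed field of characteristic zero. -/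
structure IsUniversalDomain : Prop where
  differentiallyClosed : IsDifferentiallyClosed U
  saturated : IsSaturated U
  uncountable : ℵ₀ < #U

/-- The transcendence degree of `K⟨y⟩` over `K`. -/
noncomputable def tupleOrder (K : Subfield U) {m : ℕ} (y : Fin m → U) : Cardinal :=
  Algebra.trdeg K (diffAdjoin K (Set.range y))

/-- The order of a set `X` that is definable over `K`. -/
noncomputable def order (K : Subfield U) {m : ℕ} (X : Set (Fin m → U)) : Cardinal :=
  ⨆ y : X, tupleOrder K (y : Fin m → U)

/-- `y` is a generic point of `X` over `K`. -/
def IsGeneric (K : Subfield U) {m : ℕ} (X : Set (Fin m → U)) (y : Fin m → U) : Prop :=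
  y ∈ X ∧ tupleOrder K y = order K X

/-- `z` realises `tp(y/K)`; complete types over `K` correspond to prime differential ideals. -/
def Realises (K : Subfield U) {m : ℕ} (y z : Fin m → U) : Prop :=
  ∀ p : MvPolynomial (Fin m × ℕ) K, diffEval K z p = 0 ↔ diffEval K y p = 0

/-- `tp(y/K)` is stationary. -/
def IsStationary (K : Subfield U) {m : ℕ} (y : Fin m → U) : Prop :=
  ∀ z : Fin m → U, Realises K y z → Realises (algClosure K) y z

/-- `tp(y/K)` is internal to the constants. As usual in a saturated model, the field `F` of
additional parameters is small (for `F = U` the condition would be empty). -/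
def IsInternalToConstants (K : Subfield U) {m : ℕ} (y : Fin m → U) : Prop :=
  ∃ F : Subfield U, K ≤ F ∧ IsDiffSubfield F ∧ #F < #U ∧
    ∀ z : Fin m → U, Realises K y z →
      ∃ (k : ℕ) (c : Fin k → U), (∀ j, Differential.deriv (c j) = 0) ∧
        ∀ i, z i ∈ IntermediateField.adjoin F (Set.range c)

/-- `K⟨s_0, …, s_{i-1}⟩` for a sequence `s` of finite tuples. -/
def stage (K : Subfield U) {d : ℕ → ℕ} (s : ∀ i, Fin (d i) → U) (i : ℕ) : Subfield U :=
  (diffAdjoin K (⋃ j ∈ Set.Iio i, Set.range (s j))).toSubfield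

/-- `tp(y/K)` is analysable in the constants, by a sequence `s_0, …, s_N` of finite tuples. -/
def IsAnalysable (K : Subfield U) {m : ℕ} (y : Fin m → U) : Prop :=
  ∃ (N : ℕ) (d : ℕ → ℕ) (s : ∀ i, Fin (d i) → U),
    (∀ t, y t ∈ algClosure (stage K s (N + 1))) ∧
    ∀ i ≤ N, (∀ t, s i t ∈ algClosure (stage K s i)) ∨
      (IsStationary (stage K s i) (s i) ∧ IsInternalToConstants (stage K s i) (s i))

/-- A definable set `X` over `K` is orthogonal to the constants: there are no differential field
extension `F` of `K` and `a ∈ X` such that `F⟨a⟩` contains a constant outside `F^alg`. -/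
def IsOrthogonalToConstants (K : Subfield U) {m : ℕ} (X : Set (Fin m → U)) : Prop :=
  ¬ ∃ F : Subfield U, K ≤ F ∧ IsDiffSubfield F ∧ #F < #U ∧
    ∃ a ∈ X, ∃ c ∈ diffAdjoin F (Set.range a), Differential.deriv c = 0 ∧ c ∉ algClosure F

/-- `L` is a Liouvillian extension of `F` (inside `U`). -/
def IsLiouvillianExtension (F L : Subfield U) : Prop :=
  ∃ (r : ℕ) (T : ℕ → Subfield U), T 0 = F ∧ T r = L ∧ (∀ i ≤ r, IsDiffSubfield (T i)) ∧
    ∀ i < r, ∃ α : U, T (i + 1) = (IntermediateField.adjoin (T i) {α}).toSubfield ∧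
      (Differential.deriv α ∈ T i ∨ (α ≠ 0 ∧ Differential.deriv α / α ∈ T i) ∨
        α ∈ algClosure (T i))

/-- The tuple `y` is Liouvillian over `K`. -/
def IsLiouvillian (K : Subfield U) {m : ℕ} (y : Fin m → U) : Prop :=
  ∃ L : Subfield U, IsLiouvillianExtension K L ∧ ∀ i, y i ∈ L

end DiffAlg

/-! Both parts climb a Liouvillian tower. Primitive and exponential generators alike satisfy an
affine equation z' = az + b over the field F below.

Part 1 shows that Liouvillian tuples are analysable. All transcendental solutions of such an
equation have one type, over F and over its algebraic closure alike, which gives stationarity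
(`isStationary_of_affine`). Two realisations differ by a constant summand or factor, which gives
internality.

For part 2, take the step F ⊆ F(α) at which a coordinate of f first becomes algebraic. It is not an
algebraic step, and by exchange α is algebraic over F(f). Saturation gives a constant c
transcendental over F(α). Put β = α + c or αc, and E = F(β). Then c lies in E(α), hence is algebraic
over E⟨f⟩, but it is not algebraic over E. By `mem_algClosure_of_constants`, E⟨f⟩ itself contains a
constant outside E^alg, against orthogonality. -/

namespace DiffAlg

open Cardinal

/-! ### Algebraic closure and towers of simple extensions -/

section Adjunction

variable {U : Type*} [Field U] {F L : Subfield U} {S : Set U}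

lemma le_adjoin (F : Subfield U) (S : Set U) :
    F ≤ (IntermediateField.adjoin F S).toSubfield := fun x hx =>
  (IntermediateField.adjoin F S).algebraMap_mem ⟨x, hx⟩

lemma adjoin_le_iff :
    (IntermediateField.adjoin F S).toSubfield ≤ L ↔ F ≤ L ∧ S ⊆ L := by
  constructor
  · intro h
    exact ⟨(le_adjoin F S).trans h, fun x hx => h (IntermediateField.subset_adjoin F S hx)⟩
  · rintro ⟨h₁, h₂⟩
    rw [IntermediateField.adjoin_toSubfield, Subfield.closure_le]
    rintro x (⟨y, rfl⟩ | hx)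
    · exact h₁ y.2
    · exact h₂ hx

lemma mem_algClosure {x : U} : x ∈ algClosure F ↔ IsAlgebraic F x :=
  mem_algebraicClosure_iff

lemma le_algClosure (F : Subfield U) : F ≤ algClosure F := fun x hx =>
  (algebraicClosure F U).algebraMap_mem ⟨x, hx⟩

lemma isAlgebraic_mono (h : F ≤ L) {x : U} (hx : IsAlgebraic F x) : IsAlgebraic L x := by
  let : Algebra F L := (Subfield.inclusion h).toAlgebra
  have : IsScalarTower F L U := IsScalarTower.of_algebraMap_eq fun _ => rfl
  exact hx.extendScalars (Subfield.inclusion h).injective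

lemma algClosure_mono (h : F ≤ L) : algClosure F ≤ algClosure L := fun _ hx =>
  mem_algClosure.2 (isAlgebraic_mono h (mem_algClosure.1 hx))

lemma algClosure_algClosure (F : Subfield U) : algClosure (algClosure F) = algClosure F := by
  refine le_antisymm (fun x hx => ?_) (le_algClosure _)
  have : IsAlgebraic (algebraicClosure F U) x := mem_algClosure.1 hx
  exact mem_algClosure.2 (this.restrictScalars F)

lemma algClosure_le_algClosure (h : F ≤ algClosure L) : algClosure F ≤ algClosure L :=
  (algClosure_mono h).trans (algClosure_algClosure L).le

/-- The exchange property of algebraic closure. -/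
lemma algClosure_exchange {x y : U}
    (hy : y ∈ algClosure (IntermediateField.adjoin F {x}).toSubfield) (hyF : y ∉ algClosure F) :
    x ∈ algClosure (IntermediateField.adjoin F {y}).toSubfield := by
  by_cases hx : IsAlgebraic F x
  · exact algClosure_mono (le_adjoin F {y}) (mem_algClosure.2 hx)
  have hy' : IsAlgebraic (IntermediateField.adjoin F {x}) y := mem_algClosure.1 hy
  rw [IntermediateField.isAlgebraic_adjoin_iff] at hy'
  have h := IsAlgebraic.adjoin_singleton (B := U) hx (fun h => hyF (mem_algClosure.2 h)) hy'
  have h' : IsAlgebraic (IntermediateField.adjoin F {y}) x :=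
    IntermediateField.isAlgebraic_adjoin_iff.2 h
  exact mem_algClosure.2 h'

lemma countable_adjoin [Countable F] (hS : S.Countable) :
    Countable (IntermediateField.adjoin F S).toSubfield := by
  have := hS.to_subtype
  have h := IntermediateField.cardinalMk_adjoin_le F S
  exact Cardinal.mk_le_aleph0_iff.1 (h.trans (by simp))

lemma countable_bot : Countable (⊥ : Subfield U) := by
  rw [← Subfield.closure_empty]
  exact Cardinal.mk_le_aleph0_iff.1 ((Subfield.cardinalMk_closure_le_max _).trans (by simp))

section Tower

variable {r : ℕ} {T : ℕ → Subfield U} {α : ℕ → U}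

lemma tower_le (hα : ∀ i < r, T (i + 1) = (IntermediateField.adjoin (T i) {α i}).toSubfield)
    {i j : ℕ} (hij : i ≤ j) (hj : j ≤ r) : T i ≤ T j := by
  induction j, hij using Nat.le_induction with
  | base => exact le_rfl
  | succ j hij ih => exact (ih (by omega)).trans ((le_adjoin _ _).trans (hα j (by omega)).ge)

lemma countable_tower (h0 : Countable (T 0))
    (hα : ∀ i < r, T (i + 1) = (IntermediateField.adjoin (T i) {α i}).toSubfield)
    {i : ℕ} (hi : i ≤ r) : Countable (T i) := by
  induction i with
  | zero => exact h0
  | succ i ih =>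
    have := ih (by omega)
    rw [hα i hi]
    exact countable_adjoin (Set.countable_singleton _)

end Tower

end Adjunction

/-! ### Differential subfields -/

variable {U : Type*} [Field U] [Differential U] {F L : Subfield U} {S : Set U}

lemma iterDeriv_zero (x : U) : iterDeriv 0 x = x := rfl

lemma iterDeriv_succ (j : ℕ) (x : U) :
    iterDeriv (j + 1) x = Differential.deriv (iterDeriv j x) :=
  Function.iterate_succ_apply' _ _ _

lemma iterDeriv_mem (hL : IsDiffSubfield L) {x : U} (hx : x ∈ L) (j : ℕ) : iterDeriv j x ∈ L := by
  induction j with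
  | zero => exact hx
  | succ j ih => rw [iterDeriv_succ]; exact hL _ ih

lemma isDiffSubfield_adjoin (hF : IsDiffSubfield F)
    (hS : ∀ x ∈ S, Differential.deriv x ∈ IntermediateField.adjoin F S) :
    IsDiffSubfield (IntermediateField.adjoin F S).toSubfield := by
  intro x hx
  have hx' := hx
  rw [IntermediateField.adjoin_toSubfield] at hx'
  induction hx' using Subfield.closure_induction with
  | mem x h =>
    rcases h with ⟨y, rfl⟩ | h
    · exact le_adjoin F S (hF _ y.2)
    · exact hS x h
  | one => simp
  | add x y h₁ h₂ ih₁ ih₂ => rw [map_add]; exact add_mem (ih₁ h₁) (ih₂ h₂)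
  | neg x h ih => rw [map_neg]; exact neg_mem (ih h)
  | inv x h ih =>
    rw [Derivation.leibniz_inv, smul_eq_mul]
    exact mul_mem (neg_mem (pow_mem (inv_mem h) 2)) (ih h)
  | mul x y h₁ h₂ ih₁ ih₂ =>
    rw [Derivation.leibniz, smul_eq_mul, smul_eq_mul]
    exact add_mem (mul_mem h₁ (ih₂ h₂)) (mul_mem h₂ (ih₁ h₁))

lemma isDiffSubfield_diffAdjoin (hF : IsDiffSubfield F) (S : Set U) :
    IsDiffSubfield (diffAdjoin F S).toSubfield := by
  refine isDiffSubfield_adjoin hF ?_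
  rintro _ ⟨s, hs, j, rfl⟩
  exact IntermediateField.subset_adjoin _ _ ⟨s, hs, j + 1, (iterDeriv_succ j s).symm⟩

lemma diffAdjoin_le_iff (hL : IsDiffSubfield L) :
    (diffAdjoin F S).toSubfield ≤ L ↔ F ≤ L ∧ S ⊆ L := by
  rw [diffAdjoin, adjoin_le_iff]
  refine and_congr_right fun _ => ⟨fun h s hs => h ⟨s, hs, 0, rfl⟩, ?_⟩
  rintro h _ ⟨s, hs, j, rfl⟩
  exact iterDeriv_mem hL (h hs) j

lemma subset_diffAdjoin (F : Subfield U) (S : Set U) : S ⊆ diffAdjoin F S := fun s hs =>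
  IntermediateField.subset_adjoin _ _ ⟨s, hs, 0, rfl⟩

lemma countable_diffAdjoin [Countable F] (hS : S.Countable) :
    Countable (diffAdjoin F S).toSubfield := by
  refine countable_adjoin ?_
  have : {x | ∃ s ∈ S, ∃ j : ℕ, x = iterDeriv j s} = ⋃ s ∈ S, Set.range fun j => iterDeriv j s := by
    ext x; simp [eq_comm]
  rw [this]
  exact hS.biUnion fun s _ => Set.countable_range _

/-- Countability passes to every field built below, so each is smaller than `U` and may serve as a
parameter field. -/
lemma IsFinGenDiffField.countable {K : Subfield U} (hK : IsFinGenDiffField K) : Countable K := by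
  obtain ⟨s, rfl⟩ := hK
  have := countable_bot (U := U)
  exact countable_diffAdjoin s.countable_toSet

/-! ### Constants and saturation -/

/-- A constant algebraic over a differential field `L` is algebraic over any field over which the
constants of `L` are algebraic. -/
lemma mem_algClosure_of_constants (hL : IsDiffSubfield L)
    (hc : ∀ x ∈ L, Differential.deriv x = 0 → x ∈ algClosure F)
    {c : U} (hcL : c ∈ algClosure L) (hc0 : Differential.deriv c = 0) : c ∈ algClosure F := by
  let : Differential L :=
    ⟨Derivation.mk' (AddMonoidHom.mk' (fun x : L => (⟨_, hL x x.2⟩ : L))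
      (fun a b => Subtype.ext (map_add Differential.deriv (a : U) b))).toIntLinearMap
      (fun a b => Subtype.ext (Derivation.leibniz Differential.deriv (a : U) (b : U)))⟩
  have : DifferentialAlgebra L U := ⟨fun _ => rfl⟩
  have hint : IsIntegral L c := (mem_algClosure.1 hcL).isIntegral
  set p := minpoly L c
  have hmonic : p.Monic := minpoly.monic hint
  -- As c' = 0, differentiating p(c) = 0 only differentiates the coefficients.
  have hD : Polynomial.aeval c (Differential.mapCoeffs p) = 0 := by
    have := Differential.deriv_aeval_eq c p
    rw [minpoly.aeval, map_zero, hc0, mul_zero, add_zero] at this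
    exact this.symm
  -- The leading coefficient 1 is killed, so the degree drops below that of the minimal polynomial;
  -- hence the coefficients of p are constants.
  have hp0 : Differential.mapCoeffs p = 0 := by
    by_contra hne
    have hle := minpoly.degree_le_of_ne_zero L c hne hD
    refine absurd hle (not_le.2 ?_)
    rw [Polynomial.degree_eq_natDegree hmonic.ne_zero, Polynomial.degree_lt_iff_coeff_zero]
    intro m hm
    rw [Differential.coeff_mapCoeffs]
    rcases hm.eq_or_lt with rfl | hm
    · rw [hmonic.coeff_natDegree]; simp
    · rw [Polynomial.coeff_eq_zero_of_natDegree_lt hm, map_zero]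
  have hcoeff : ∀ k, ((p.coeff k : L) : U) ∈ algClosure F := by
    intro k
    refine hc _ (p.coeff k).2 ?_
    have h : Differential.deriv (p.coeff k) = 0 := by
      rw [← Differential.coeff_mapCoeffs, hp0, Polynomial.coeff_zero]
    exact congrArg Subtype.val h
  have hlift : p.map (algebraMap L U) ∈ Polynomial.lifts (algebraMap (algClosure F) U) := by
    rw [Polynomial.lifts_iff_coeff_lifts]
    intro k
    rw [Polynomial.coeff_map]
    exact ⟨⟨_, hcoeff k⟩, rfl⟩
  obtain ⟨q, hq⟩ := hlift
  rw [← algClosure_algClosure, mem_algClosure]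
  replace hq : q.map (algebraMap (algClosure F) U) = p.map (algebraMap L U) := hq
  refine ⟨q, ?_, ?_⟩
  · rintro rfl
    exact (hmonic.map (algebraMap L U)).ne_zero (by rw [← hq, Polynomial.map_zero])
  · rw [← Polynomial.eval_map_algebraMap, hq, Polynomial.eval_map_algebraMap, minpoly.aeval]

/-- In a universal domain, every countable differential field has a constant that is
transcendental over it. -/
lemma exists_constant_notMem_algClosure [CharZero U] (hU : IsUniversalDomain U)
    (L : Subfield U) [Countable L] : ∃ c : U, Differential.deriv c = 0 ∧ c ∉ algClosure L := by
  have hle : L ≤ diffClosure (L : Set U) := subset_diffAdjoin ⊥ (L : Set U)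
  let K := diffClosure (L : Set U)
  let Z : Polynomial L → Set (Fin 1 → U) := fun p => {y | Polynomial.aeval (y 0) p = 0}
  let C : Set (Fin 1 → U) := {y | Differential.deriv (y 0) = 0}
  have hC : IsDefinableOver K C := by
    convert! IsDefinableOver.kolchinClosed (K := K) (m := 1) {MvPolynomial.X (0, 1)} using 1
    ext y
    simp [C, diffEval, iterDeriv]
  have hZ : ∀ p, IsDefinableOver K (Z p) := by
    intro p
    convert! IsDefinableOver.kolchinClosed (K := K) (m := 1)
      {Polynomial.aeval (MvPolynomial.X (0, 0)) (p.map (Subfield.inclusion hle))} using 1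
    ext y
    have : diffEval K y (Polynomial.aeval (MvPolynomial.X (0, 0))
        (p.map (Subfield.inclusion hle))) = Polynomial.aeval (y 0) p := by
      rw [diffEval, ← Polynomial.aeval_algHom_apply, MvPolynomial.aeval_X,
        ← Polynomial.eval_map_algebraMap, Polynomial.map_map, ← Polynomial.eval_map_algebraMap]
      rfl
    simp [Z, this]
  let S : Set (Set (Fin 1 → U)) := insert C {X | ∃ p : Polynomial L, p ≠ 0 ∧ X = (Z p)ᶜ}
  have hcard : #(L : Set U) < #U :=
    (Cardinal.mk_le_aleph0_iff.2 (inferInstanceAs (Countable L))).trans_lt hU.uncountable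
  -- Natural numbers witness finite satisfiability: they are constants, and a nonzero polynomial has
  -- finitely many roots.
  have hfin : ∀ X ∈ S, {q : ℕ | (fun _ => (q : U)) ∉ X}.Finite := by
    rintro X (rfl | ⟨p, hp, rfl⟩)
    · simp [C]
    · have hp' : p.map (algebraMap L U) ≠ 0 := by
        rwa [Ne, Polynomial.map_eq_zero]
      refine ((Polynomial.finite_setOfPred_isRoot hp').preimage
        (f := fun q : ℕ => (q : U)) Nat.cast_injective.injOn).subset ?_
      intro q hq
      simpa [Z, ← Polynomial.eval_map_algebraMap] using hq
  obtain ⟨y, hy⟩ := hU.saturated L hcard 1 S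
    (by
      rintro X (rfl | ⟨p, -, rfl⟩)
      · exact hC
      · exact (hZ p).compl)
    (by
      intro T hT
      have hbad : (⋃ X ∈ T, {q : ℕ | (fun _ => (q : U)) ∉ X}).Finite :=
        T.finite_toSet.biUnion fun X hX => hfin X (hT hX)
      obtain ⟨q, hq⟩ := hbad.exists_notMem
      refine ⟨fun _ => (q : U), fun X hX => ?_⟩
      by_contra h
      exact hq (Set.mem_biUnion hX h))
  refine ⟨y 0, hy C (Set.mem_insert _ _), fun halg => ?_⟩
  obtain ⟨p, hp, hp0⟩ := mem_algClosure.1 halg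
  exact hy _ (Set.mem_insert_of_mem _ ⟨p, hp, rfl⟩) hp0

/-! ### First-order affine equations -/

/-- All iterated derivatives of a solution of `z' = a z + b` are affine functions of the
solution. -/
lemma exists_iterDeriv_eq_affine (hF : IsDiffSubfield F) {a b : U} (ha : a ∈ F) (hb : b ∈ F) :
    ∃ A B : ℕ → F, ∀ z : U, Differential.deriv z = a * z + b →
      ∀ j, iterDeriv j z = A j * z + B j := by
  have h : ∀ j, ∃ AB : F × F, ∀ z : U, Differential.deriv z = a * z + b →
      iterDeriv j z = AB.1 * z + AB.2 := by
    intro j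
    induction j with
    | zero => exact ⟨(1, 0), fun z _ => by simp [iterDeriv_zero]⟩
    | succ j ih =>
      obtain ⟨⟨A, B⟩, h⟩ := ih
      refine ⟨(⟨_, hF _ A.2⟩ + A * ⟨a, ha⟩, A * ⟨b, hb⟩ + ⟨_, hF _ B.2⟩), fun z hz => ?_⟩
      rw [iterDeriv_succ, h z hz, map_add, Derivation.leibniz, hz]
      simp only [smul_eq_mul, Subfield.coe_add, Subfield.coe_mul]
      ring
  choose AB hAB using h
  exact ⟨fun j => (AB j).1, fun j => (AB j).2, fun z hz j => hAB j z hz⟩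

/-- Two solutions of `z' = a z + b` that are transcendental over `L` have the same type
over `L`. -/
lemma realises_of_affine (hF : IsDiffSubfield F) (hFL : F ≤ L) {a b : U} (ha : a ∈ F) (hb : b ∈ F)
    {y z : Fin 1 → U} (hy : Differential.deriv (y 0) = a * y 0 + b)
    (hz : Differential.deriv (z 0) = a * z 0 + b)
    (hyL : y 0 ∉ algClosure L) (hzL : z 0 ∉ algClosure L) : Realises L y z := by
  obtain ⟨A, B, hAB⟩ := exists_iterDeriv_eq_affine hF ha hb
  -- On solutions, a differential polynomial reduces to an ordinary polynomial in z; only the zero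
  -- polynomial vanishes at a transcendental point.
  let φ : MvPolynomial (Fin 1 × ℕ) L →ₐ[L] Polynomial L := MvPolynomial.aeval fun v =>
    Polynomial.C (Subfield.inclusion hFL (A v.2)) * Polynomial.X +
      Polynomial.C (Subfield.inclusion hFL (B v.2))
  have key : ∀ w : Fin 1 → U, Differential.deriv (w 0) = a * w 0 + b → ∀ p,
      diffEval L w p = Polynomial.aeval (w 0) (φ p) := by
    intro w hw p
    rw [diffEval, ← AlgHom.comp_apply]
    congr 1
    ext v
    obtain ⟨i, j⟩ := v
    obtain rfl := Subsingleton.elim i 0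
    simp [φ, hAB _ hw]
    rfl
  have hzero : ∀ w : U, w ∉ algClosure L → ∀ q : Polynomial L,
      Polynomial.aeval w q = 0 ↔ q = 0 := by
    intro w hw q
    refine ⟨fun h => ?_, fun h => by rw [h, map_zero]⟩
    by_contra hq
    exact hw (mem_algClosure.2 ⟨q, hq, h⟩)
  intro p
  rw [key z hz, key y hy, hzero _ hzL, hzero _ hyL]

lemma Realises.deriv_eq_affine {a b : U} (ha : a ∈ F) (hb : b ∈ F) {y z : Fin 1 → U}
    (h : Realises F y z) (hy : Differential.deriv (y 0) = a * y 0 + b) :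
    Differential.deriv (z 0) = a * z 0 + b := by
  have key : ∀ w : Fin 1 → U, diffEval F w (MvPolynomial.X (0, 1) -
      (MvPolynomial.C ⟨a, ha⟩ * MvPolynomial.X (0, 0) + MvPolynomial.C ⟨b, hb⟩)) =
      Differential.deriv (w 0) - (a * w 0 + b) := by
    intro w
    simp [diffEval, iterDeriv, MvPolynomial.algHom_C]
    rfl
  rw [← sub_eq_zero, ← key z, h, key y, hy, sub_self]

lemma Realises.notMem_algClosure {m : ℕ} {y z : Fin m → U} (h : Realises F y z) {i : Fin m}
    (hy : y i ∉ algClosure F) : z i ∉ algClosure F := by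
  rintro hz
  obtain ⟨p, hp, hpz⟩ := mem_algClosure.1 hz
  have key : ∀ w : Fin m → U, diffEval F w (Polynomial.aeval (MvPolynomial.X (i, 0)) p) =
      Polynomial.aeval (w i) p := by
    intro w
    rw [diffEval, ← Polynomial.aeval_algHom_apply, MvPolynomial.aeval_X, iterDeriv_zero]
  exact hy (mem_algClosure.2 ⟨p, hp, by rw [← key y, ← h, key z, hpz]⟩)

lemma isStationary_of_affine (hF : IsDiffSubfield F) {a b : U} (ha : a ∈ F) (hb : b ∈ F)
    {y : Fin 1 → U} (hy : Differential.deriv (y 0) = a * y 0 + b) (hyF : y 0 ∉ algClosure F) :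
    IsStationary F y := by
  intro z h
  refine realises_of_affine hF (le_algClosure F) ha hb hy (h.deriv_eq_affine ha hb hy) ?_ ?_ <;>
    rw [algClosure_algClosure]
  exacts [hyF, h.notMem_algClosure hyF]

lemma deriv_div_eq_zero {y z a : U} (hy : Differential.deriv y = a * y)
    (hz : Differential.deriv z = a * z) : Differential.deriv (z / y) = 0 := by
  rw [Derivation.leibniz_div, hy, hz]
  simp only [smul_eq_mul]
  ring

/-- A generator of a primitive or an exponential extension generates a differential field. -/
lemma isDiffSubfield_adjoin_affine (hF : IsDiffSubfield F) {a b α : U} (ha : a ∈ F) (hb : b ∈ F)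
    (h : Differential.deriv α = a * α + b) :
    IsDiffSubfield (IntermediateField.adjoin F {α}).toSubfield := by
  refine isDiffSubfield_adjoin hF ?_
  rintro x rfl
  rw [h]
  exact add_mem (mul_mem (le_adjoin F {x} ha) (IntermediateField.mem_adjoin_simple_self F x))
    (le_adjoin F {x} hb)

/-! ### Primitive and exponential generators -/

/-- `α` generates a primitive or an exponential extension of `F`. -/
def IsElementaryLiouvillian (F : Subfield U) (α : U) : Prop :=
  Differential.deriv α ∈ F ∨ (α ≠ 0 ∧ Differential.deriv α / α ∈ F)

lemma IsElementaryLiouvillian.exists_affine {α : U} (h : IsElementaryLiouvillian F α) :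
    ∃ a ∈ F, ∃ b ∈ F, Differential.deriv α = a * α + b := by
  rcases h with h | ⟨h0, h⟩
  · exact ⟨0, zero_mem F, _, h, by ring⟩
  · exact ⟨_, h, 0, zero_mem F, by field_simp; ring⟩

/-- With α itself as extra parameter, a realisation z is recovered from the constant z - α or z / α.
-/
lemma IsElementaryLiouvillian.isInternalToConstants {α : U} (hF : IsDiffSubfield F) [Countable F]
    (hU : ℵ₀ < #U) (h : IsElementaryLiouvillian F α) :
    IsInternalToConstants F (fun _ : Fin 1 => α) := by
  obtain ⟨a, ha, b, hb, hab⟩ := h.exists_affine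
  have hcount := countable_adjoin (F := F) (Set.countable_singleton α)
  refine ⟨(IntermediateField.adjoin F {α}).toSubfield, le_adjoin F {α},
    isDiffSubfield_adjoin_affine hF ha hb hab, (Cardinal.mk_le_aleph0_iff.2 hcount).trans_lt hU,
    fun z hz => ?_⟩
  set M := (IntermediateField.adjoin F {α}).toSubfield
  have hα : α ∈ M := IntermediateField.mem_adjoin_simple_self F α
  have hαc : ∀ c : Fin 1 → U, α ∈ IntermediateField.adjoin M (Set.range c) := fun c =>
    le_adjoin M _ hα
  have hcc : ∀ c : Fin 1 → U, c 0 ∈ IntermediateField.adjoin M (Set.range c) := fun c =>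
    IntermediateField.subset_adjoin _ _ ⟨0, rfl⟩
  rcases h with h | ⟨h0, h⟩
  · have hz' := hz.deriv_eq_affine (zero_mem F) h (by ring)
    refine ⟨1, fun _ => z 0 - α, fun _ => ?_, fun i => ?_⟩
    · rw [map_sub, hz']; ring
    · obtain rfl := Subsingleton.elim i 0
      simpa using add_mem (hcc fun _ => z 0 - α) (hαc fun _ => z 0 - α)
  · have hz' := hz.deriv_eq_affine h (zero_mem F) (by field_simp; ring)
    rw [add_zero] at hz'
    refine ⟨1, fun _ => z 0 / α, fun _ => deriv_div_eq_zero (by field_simp) hz', fun i => ?_⟩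
    obtain rfl := Subsingleton.elim i 0
    simpa [h0] using mul_mem (hcc fun _ => z 0 / α) (hαc fun _ => z 0 / α)

/-- If `α` is transcendental over `F`, then some `β` that is primitive or exponential over `F`
admits a constant in `F(β, α)` which is transcendental over `F(β)`. -/
lemma IsElementaryLiouvillian.exists_independent [CharZero U] (hU : IsUniversalDomain U)
    [Countable F] {α : U} (hα : α ∉ algClosure F) (h : IsElementaryLiouvillian F α) :
    ∃ β c : U, IsElementaryLiouvillian F β ∧ Differential.deriv c = 0 ∧
      c ∉ algClosure (IntermediateField.adjoin F {β}).toSubfield ∧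
      c ∈ IntermediateField.adjoin (IntermediateField.adjoin F {β}).toSubfield {α} := by
  have := countable_adjoin (F := F) (Set.countable_singleton α)
  obtain ⟨c, hc0, hc⟩ := exists_constant_notMem_algClosure hU
    (IntermediateField.adjoin F {α}).toSubfield
  have hcF : c ∉ algClosure F := fun h => hc (algClosure_mono (le_adjoin F {α}) h)
  have hcne : c ≠ 0 := by rintro rfl; exact hc (zero_mem _)
  have hα0 : α ≠ 0 := by rintro rfl; exact hα (zero_mem _)
  -- If c were algebraic over F(β), exchange would make β, hence α, algebraic over F(c); a second
  -- exchange would make c algebraic over F(α).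
  have indep : ∀ β : U, (∀ M : Subfield U, β ∈ M → c ∈ M → α ∈ M) →
      c ∉ algClosure (IntermediateField.adjoin F {β}).toSubfield := by
    intro β hβ hcβ
    refine hc (algClosure_exchange ?_ hα)
    exact hβ _ (algClosure_exchange hcβ hcF)
      (le_algClosure _ (IntermediateField.mem_adjoin_simple_self F c))
  have hmem : ∀ β : U, (∀ M : Subfield U, β ∈ M → α ∈ M → c ∈ M) →
      c ∈ IntermediateField.adjoin (IntermediateField.adjoin F {β}).toSubfield {α} := by
    intro β hβ
    exact hβ (IntermediateField.adjoin (IntermediateField.adjoin F {β}).toSubfield {α}).toSubfield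
      (le_adjoin _ _ (IntermediateField.mem_adjoin_simple_self F β))
      (IntermediateField.mem_adjoin_simple_self _ α)
  rcases h with h | ⟨-, h⟩
  · refine ⟨α + c, c, Or.inl (by rwa [map_add, hc0, add_zero]), hc0, indep _ ?_, hmem _ ?_⟩
    · intro M h₁ h₂; simpa using sub_mem h₁ h₂
    · intro M h₁ h₂; simpa using sub_mem h₁ h₂
  · refine ⟨α * c, c, Or.inr ⟨mul_ne_zero hα0 hcne, ?_⟩, hc0, indep _ ?_, hmem _ ?_⟩
    · rw [Derivation.leibniz, hc0]
      simp only [smul_eq_mul, mul_zero, zero_add]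
      rwa [mul_comm α c, mul_div_mul_left _ _ hcne]
    · intro M h₁ h₂; simpa [hcne] using div_mem h₁ h₂
    · intro M h₁ h₂; simpa [hα0] using div_mem h₁ h₂

/-- A set with a point that is algebraic over a transcendental primitive or exponential extension
of `F`, but not over `F`, is not orthogonal to the constants. -/
lemma IsElementaryLiouvillian.not_isOrthogonalToConstants [CharZero U] (hU : IsUniversalDomain U)
    {K : Subfield U} (hKF : K ≤ F) (hF : IsDiffSubfield F) [Countable F] {α : U}
    (h : IsElementaryLiouvillian F α) {m : ℕ} {X : Set (Fin m → U)} {f : Fin m → U} (hf : f ∈ X)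
    {i : Fin m} (hfF : f i ∉ algClosure F)
    (hfα : f i ∈ algClosure (IntermediateField.adjoin F {α}).toSubfield) :
    ¬ IsOrthogonalToConstants K X := by
  refine not_not.2 ?_
  have hα : α ∉ algClosure F := fun hα =>
    hfF (algClosure_le_algClosure
      (adjoin_le_iff.2 ⟨le_algClosure F, Set.singleton_subset_iff.2 hα⟩) hfα)
  obtain ⟨β, c, hβ, hc0, hcβ, hcα⟩ := h.exists_independent hU hα
  obtain ⟨a, ha, b, hb, hab⟩ := hβ.exists_affine
  set E := (IntermediateField.adjoin F {β}).toSubfield with hE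
  have hEdiff : IsDiffSubfield E := isDiffSubfield_adjoin_affine hF ha hb hab
  have hEcount : Countable E := countable_adjoin (Set.countable_singleton β)
  refine ⟨E, hKF.trans (le_adjoin F {β}), hEdiff,
    (Cardinal.mk_le_aleph0_iff.2 hEcount).trans_lt hU.uncountable, f, hf, ?_⟩
  by_contra! hcon
  refine hcβ (mem_algClosure_of_constants (isDiffSubfield_diffAdjoin hEdiff (Set.range f))
    hcon ?_ hc0)
  -- By exchange α is algebraic over F(f i), which lies in E⟨f⟩.
  have hαf : α ∈ algClosure (diffAdjoin E (Set.range f)).toSubfield := by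
    refine algClosure_mono ?_ (algClosure_exchange hfα hfF)
    exact adjoin_le_iff.2 ⟨(le_adjoin F {β}).trans (le_adjoin E _),
      Set.singleton_subset_iff.2 (subset_diffAdjoin E _ ⟨i, rfl⟩)⟩
  exact adjoin_le_iff.2 ⟨(le_adjoin E _).trans (le_algClosure _),
    Set.singleton_subset_iff.2 hαf⟩ hcα

/-! ### Liouvillian towers -/

section Tower

variable {K : Subfield U} {r : ℕ} {T : ℕ → Subfield U} {α : ℕ → U}

lemma stage_mono (K : Subfield U) {d : ℕ → ℕ} (s : ∀ i, Fin (d i) → U) {i j : ℕ} (hij : i ≤ j) :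
    stage K s i ≤ stage K s j := by
  refine adjoin_le_iff.2 ⟨le_adjoin _ _, ?_⟩
  rintro _ ⟨x, hx, k, rfl⟩
  refine IntermediateField.subset_adjoin _ _ ⟨x, ?_, k, rfl⟩
  exact Set.biUnion_subset_biUnion_left (Set.Iio_subset_Iio hij) hx

lemma stage_eq_tower (h0 : T 0 = K) (hdiff : ∀ i ≤ r, IsDiffSubfield (T i))
    (hα : ∀ i < r, T (i + 1) = (IntermediateField.adjoin (T i) {α i}).toSubfield)
    {s : ∀ _ : ℕ, Fin 1 → U} (hs : ∀ i < r, s i = fun _ => α i) {i : ℕ} (hi : i ≤ r) :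
    stage K (d := fun _ => 1) s i = T i := by
  refine le_antisymm ?_ ?_
  · refine (diffAdjoin_le_iff (hdiff i hi)).2 ⟨h0 ▸ tower_le hα (Nat.zero_le i) hi, ?_⟩
    refine Set.iUnion₂_subset fun j hj => ?_
    have hji : j < i := hj
    rw [hs j (by omega)]
    rintro _ ⟨_, rfl⟩
    refine tower_le hα hji hi ?_
    rw [hα j (by omega)]
    exact IntermediateField.mem_adjoin_simple_self _ _
  · induction i with
    | zero => rw [h0]; exact le_adjoin _ _
    | succ i ih =>
      rw [hα i hi, adjoin_le_iff, Set.singleton_subset_iff]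
      refine ⟨(ih (by omega)).trans (stage_mono K _ (Nat.le_succ i)), ?_⟩
      refine subset_diffAdjoin K _ (Set.mem_biUnion (Set.mem_Iio.2 (Nat.lt_succ_self i)) ?_)
      exact ⟨0, by rw [hs i hi]⟩

end Tower

/-- A tuple that is Liouvillian over a countable field is analysable in the constants. -/
lemma IsLiouvillian.isAnalysable {K : Subfield U} [hK : Countable K] (hU : ℵ₀ < #U)
    {m : ℕ} {y : Fin m → U} (h : IsLiouvillian K y) : IsAnalysable K y := by
  obtain ⟨L, ⟨r, T, h0, hr, hdiff, hstep⟩, hy⟩ := h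
  choose! α hα hstep using hstep
  -- An analysis has entries 0, …, N. Taking N = r, also when r = 0, leaves entry r to be filled by
  -- the algebraic element 0.
  let s : ∀ _ : ℕ, Fin 1 → U := fun i _ => if i < r then α i else 0
  have hs : ∀ i < r, s i = fun _ => α i := fun i hi => by simp [s, hi]
  have hstage : ∀ i ≤ r, stage K (d := fun _ => 1) s i = T i := fun i hi =>
    stage_eq_tower h0 hdiff hα hs hi
  refine ⟨r, fun _ => 1, s, fun t => ?_, fun i hi => ?_⟩
  · refine le_algClosure _ (stage_mono K _ (Nat.le_succ r) ?_)
    rw [hstage r le_rfl, hr]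
    exact hy t
  rw [hstage i hi]
  rcases hi.lt_or_eq with hi' | rfl
  · rw [hs i hi']
    by_cases halg : α i ∈ algClosure (T i)
    · exact Or.inl fun _ => halg
    have hel : IsElementaryLiouvillian (T i) (α i) := by
      rcases hstep i hi' with h | h | h
      exacts [Or.inl h, Or.inr h, absurd h halg]
    have := countable_tower (h0 ▸ hK) hα hi
    obtain ⟨a, ha, b, hb, hab⟩ := hel.exists_affine
    exact Or.inr ⟨isStationary_of_affine (hdiff i hi) ha hb hab halg,
      hel.isInternalToConstants (hdiff i hi) hU⟩
  · refine Or.inl fun t => ?_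
    simp only [s, lt_irrefl, if_false]
    exact zero_mem _

/-- A set that is orthogonal to the constants has no Liouvillian points outside `K^alg`. -/
lemma IsOrthogonalToConstants.not_isLiouvillian [CharZero U] (hU : IsUniversalDomain U)
    {K : Subfield U} [hK : Countable K] {m : ℕ} {X : Set (Fin m → U)}
    (hX : IsOrthogonalToConstants K X) {f : Fin m → U} (hf : f ∈ X) {i : Fin m}
    (hfi : f i ∉ algClosure K) : ¬ IsLiouvillian K f := by
  rintro ⟨L, ⟨r, T, h0, hr, hdiff, hstep⟩, hfL⟩
  choose! α hα hstep using hstep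
  have hnot : ∀ j ≤ r, f i ∉ algClosure (T j) := by
    intro j hj
    induction j with
    | zero => rwa [h0]
    | succ j ih =>
      have hfj := ih (by omega)
      intro hmem
      rw [hα j hj] at hmem
      have hKj : K ≤ T j := h0 ▸ tower_le hα (Nat.zero_le j) (by omega)
      have := countable_tower (h0 ▸ hK) hα (Nat.le_of_lt hj)
      have hel : IsElementaryLiouvillian (T j) (α j) := by
        rcases hstep j hj with h | h | h
        -- An algebraic step does not enlarge the algebraic closure, so f i cannot become algebraic
        -- there.
        exacts [Or.inl h, Or.inr h, absurd (algClosure_le_algClosure (adjoin_le_iff.2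
          ⟨le_algClosure _, Set.singleton_subset_iff.2 h⟩) hmem) hfj]
      exact hel.not_isOrthogonalToConstants hU hKj (hdiff j (by omega)) hf hfj hmem hX
  exact hnot r le_rfl (le_algClosure _ (hr ▸ hfL i))

end DiffAlg

theorem theorem4 {U : Type*} [Field U] [CharZero U] [Differential U]
    (hU : DiffAlg.IsUniversalDomain U)
    (K : Subfield U) (hK : DiffAlg.IsFinGenDiffField K)
    {m : ℕ} (n : ℕ) (X : Set (Fin m → U)) (hX : DiffAlg.IsDefinableOver K X)
    (hn : DiffAlg.order K X = n) :
    (∀ y : Fin m → U, DiffAlg.IsGeneric K X y →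
      ¬ DiffAlg.IsAnalysable K y → ¬ DiffAlg.IsLiouvillian K y) ∧
    (DiffAlg.IsOrthogonalToConstants K X →
      ∀ f ∈ X, (∃ i, f i ∉ DiffAlg.algClosure K) → ¬ DiffAlg.IsLiouvillian K f) := by
  have := hK.countable
  exact ⟨fun y _ hy hL => hy (hL.isAnalysable hU.uncountable),
    fun hort f hf ⟨i, hi⟩ => hort.not_isLiouvillian hU hf hi⟩
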